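/- Let $\Pi=\mathrm{PGL}_2(\mathbb Z)=\mathrm{GL}_2(\mathbb Z)/\{\pm1\}$, let $\Gamma=\mathrm{PSL}_2(\mathbb Z)\le\Pi$, and let $L,N,S,R,F\in\Pi$ be the classes of $$\begin{pmatrix}1&0\\1&1\end{pmatrix},\ \begin{pmatrix}1&1\\0&1\end{pmatrix},\ \begin{pmatrix}0&-1\\1&0\end{pmatrix},\ \begin{pmatrix}1&-1\\1&0\end{pmatrix},\ \begin{pmatrix}0&1\\1&0\end{pmatrix}.$$ A closed interval $[p/q,p'/q']\subseteq[0,\infty]$ with $p,q,p',q'\in\mathbb Z_{\ge0}$ (where $1/0=\infty$) is unimodular if $\det\begin{pmatrix}p&p'\\q&q'\end{pmatrix}=-1$. Let $n\ge2$, let $\Delta_0,\dots,\Delta_{n-1}$ be unimodular intervals, listed from left to right, that cover $[0,\infty]$ and of which any two distinct ones meet at most in a common endpoint, and let $e_0,\dots,e_{n-1}\in\{+1,-1\}$. The slow continued fraction algorithm $T$ determined by these data is the map on $[0,\infty]$ (possibly two-valued at common endpoints of consecutive intervals) that on $\Delta_a=[p/q,p'/q']$ is the projective map induced by $A_a^{-1}$,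 where $$A_a^{-1}=F^{(e_a+1)/2}\begin{pmatrix}p&p'\\q&q'\end{pmatrix}^{-1}\in\Pi .$$ The elements $A_0,\dots,A_{n-1}$ are called the inverse branches of $T$, and $\Sigma_T=\langle A_0,\dots,A_{n-1}\rangle\le\Pi$. Then $\langle R,SRS\rangle$ is the unique subgroup of index $2$ of $\Gamma$. Moreover, for every slow continued fraction algorithm $T$: all inverse branches $A_a$ have positive determinant if and only if $T$ is increasing on each interval $\Delta_a$; and in this case $\Sigma_T$ equals either $\Gamma$ or $\langle R,SRS\rangle$, and $\Sigma_T=\Gamma$ if and only if at least one $A_a$ is a product of an odd number of factors each of which is $L$ or $N$. -/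

import Mathlib

namespace SlowCF

open Matrix

open scoped ENNReal NNReal

/-- The group `Π = PGL₂(ℤ)`, i.e. `GL₂(ℤ)` modulo its center `{±1}`. -/
abbrev PG : Type := Matrix.ProjGenLinGroup (Fin 2) ℤ

/-- The class in `PGL₂(ℤ)` of an integer matrix with invertible determinant. -/
noncomputable def cls (M : Matrix (Fin 2) (Fin 2) ℤ) (h : IsUnit M.det) : PG :=
  Matrix.ProjGenLinGroup.mk (Matrix.GeneralLinearGroup.mk'' M h)

/-- `Γ = PSL₂(ℤ)`, as a subgroup of `PGL₂(ℤ)` through the canonical embedding. -/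
def Gam : Subgroup PG :=
  (Matrix.ProjectiveSpecialLinearGroup.toPGL (n := Fin 2) (R := ℤ)).range

noncomputable def L : PG := cls !![1, 0; 1, 1] (by simp [Matrix.det_fin_two])

noncomputable def N : PG := cls !![1, 1; 0, 1] (by simp [Matrix.det_fin_two])

noncomputable def S : PG := cls !![0, -1; 1, 0] (by simp [Matrix.det_fin_two])

noncomputable def R : PG := cls !![1, -1; 1, 0] (by simp [Matrix.det_fin_two])

noncomputable def F : PG := cls !![0, 1; 1, 0] (by simp [Matrix.det_fin_two])

/-- The element `A` of `PGL₂(ℤ)` has positive determinant (the two matrices `±M` representing `A`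
have the same determinant). -/
def PosDet (A : PG) : Prop :=
  ∃ M : Matrix.GeneralLinearGroup (Fin 2) ℤ,
    Matrix.ProjGenLinGroup.mk M = A ∧ 0 < (M : Matrix (Fin 2) (Fin 2) ℤ).det

/-- `y = A * x` for the projective action of `PGL₂(ℤ)` on `ℙ¹(ℝ)`, where `x = u / v` and
`y = u' / v'` are points of `[0, ∞] ⊆ ℙ¹(ℝ)` given by nonnegative homogeneous coordinates
(`u / 0 = ∞` for `u ≠ 0`). -/
def MapsTo (A : PG) (x y : ℝ≥0∞) : Prop :=
  ∃ (M : Matrix.GeneralLinearGroup (Fin 2) ℤ) (u v u' v' : ℝ≥0),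
    Matrix.ProjGenLinGroup.mk M = A ∧
    (u ≠ 0 ∨ v ≠ 0) ∧ (u' ≠ 0 ∨ v' ≠ 0) ∧
    x = (u : ℝ≥0∞) / (v : ℝ≥0∞) ∧ y = (u' : ℝ≥0∞) / (v' : ℝ≥0∞) ∧
    (M 0 0 : ℝ) * (u : ℝ) + (M 0 1 : ℝ) * (v : ℝ) = (u' : ℝ) ∧
    (M 1 0 : ℝ) * (u : ℝ) + (M 1 1 : ℝ) * (v : ℝ) = (v' : ℝ)

/-- A unimodular interval `[p/q, p'/q']` contained in `[0, ∞]`: its endpoints are fractions with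
nonnegative entries (`1/0 = ∞` allowed) such that `det (p p'; q q') = -1`. -/
structure UnimodularInterval where
  p : ℕ
  q : ℕ
  p' : ℕ
  q' : ℕ
  det_eq : (p : ℤ) * (q' : ℤ) - (p' : ℤ) * (q : ℤ) = -1

namespace UnimodularInterval

/-- The left endpoint `p/q`; the determinant condition forces `q ≠ 0`. -/
noncomputable def left (I : UnimodularInterval) : ℝ≥0∞ := (I.p : ℝ≥0∞) / (I.q : ℝ≥0∞)

/-- The right endpoint `p'/q'`, equal to `∞` if `q' = 0` (the determinant condition forces
`p' ≠ 0`). -/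
noncomputable def right (I : UnimodularInterval) : ℝ≥0∞ := (I.p' : ℝ≥0∞) / (I.q' : ℝ≥0∞)

/-- The interval as a subset of `[0, ∞]`. -/
def toSet (I : UnimodularInterval) : Set ℝ≥0∞ := Set.Icc I.left I.right

/-- The class of the matrix `(p p'; q q')`. -/
noncomputable def elt (I : UnimodularInterval) : PG :=
  cls !![(I.p : ℤ), (I.p' : ℤ); (I.q : ℤ), (I.q' : ℤ)] (by
    rw [Matrix.det_fin_two_of, I.det_eq]
    exact isUnit_one.neg)

end UnimodularInterval

/-- The data `{(Δ_a, e_a)}` determining a slow continued fraction algorithm: a unimodular partition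
`Δ_0, …, Δ_{n-1}` of `[0, ∞]`, listed in consecutive order, and a choice of signs `e_a = ±1`. -/
structure SlowAlgorithm where
  n : ℕ
  two_le : 2 ≤ n
  Δ : Fin n → UnimodularInterval
  e : Fin n → ℤˣ
  /-- The intervals cover `[0, ∞]`. -/
  cover : (⋃ a, (Δ a).toSet) = Set.univ
  /-- Distinct intervals meet at most in a common endpoint, and they are listed from left to
  right. -/
  sorted : ∀ a b : Fin n, a < b → (Δ a).right ≤ (Δ b).left

namespace SlowAlgorithm

variable (T : SlowAlgorithm)

/-- The inverse branch `A_a`, where `A_a⁻¹ = F ^ ((e_a + 1) / 2) * (p p'; q q')⁻¹`. -/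
noncomputable def branch (a : Fin T.n) : PG :=
  (F ^ (((T.e a : ℤ) + 1) / 2) * (T.Δ a).elt⁻¹)⁻¹

/-- The graph of the restriction of the algorithm to `Δ_a`: the map `[0, ∞] → [0, ∞]` determined by
the data is, on `Δ_a`, the map induced by `A_a⁻¹`. -/
def GraphOn (a : Fin T.n) (x y : ℝ≥0∞) : Prop :=
  x ∈ (T.Δ a).toSet ∧ MapsTo (T.branch a)⁻¹ x y

/-- The algorithm is (strictly) increasing on the interval `Δ_a`. -/
def IncreasingOn (a : Fin T.n) : Prop :=
  ∀ x₁ x₂ y₁ y₂ : ℝ≥0∞, T.GraphOn a x₁ y₁ → T.GraphOn a x₂ y₂ → x₁ < x₂ → y₁ < y₂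

/-- `Σ_T`, the subgroup of `PGL₂(ℤ)` generated by the inverse branches. -/
noncomputable def Sig : Subgroup PG := Subgroup.closure (Set.range T.branch)

end SlowAlgorithm

/-- `A` is a product of an odd number of factors, each equal to `L` or to `N`. -/
def IsOddLNProduct (A : PG) : Prop :=
  ∃ w : List PG, (∀ B ∈ w, B = L ∨ B = N) ∧ Odd w.length ∧ w.prod = A

/-- The subgroup `⟨R, SRS⟩` of `PGL₂(ℤ)`. -/
noncomputable def RSRS : Subgroup PG := Subgroup.closure {R, S * R * S}

end SlowCF

/-! Since Γ is generated by `S` and `N = RS`, the subgroup ⟨R, SRS⟩ has at most the two cosets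
represented by 1 and `S`. The sign character of GL₂(𝔽₂) ≅ S₃ kills `R` and `SRS` but not `S`, so the
index is exactly 2. A subgroup of index 2 contains every element of order 3, in particular `R` and
`SRS`; this gives uniqueness.

The branch `A_a` has determinant `e_a`, and the sign of the determinant decides whether the
projective map preserves order.

If all `e_a = 1`, the branches are the matrices of consecutive vertices of a Farey path from 0/1 to
1/0. The quotients of consecutive branches are elements `N⁻ᵏS`, where k measures the turn of the
path at a vertex. Near the vertex of largest numerator plus denominator these turns are so
constrained that they produce `SRS` and `N² = R · SRS`, hence ⟨R, SRS⟩ ≤ Σ_T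
(`RSRS_le_of_farey_path`). As the index is 2, only two groups are possible for Σ_T, and the sign
separates them: each branch is a word in `L` and `N` by Euclid's algorithm (`exists_LN_word`), and
its sign is the parity of the length. -/

namespace SlowCF

open Matrix MatrixGroups

/-! ### Matrix computations in PSL₂(ℤ) ⊆ PGL₂(ℤ) -/

/-- The canonical map `SL₂(ℤ) → PGL₂(ℤ)`. -/
abbrev ofSL : SL(2, ℤ) →* PG := SpecialLinearGroup.toPGL

lemma cls_eq_ofSL (A : SL(2, ℤ)) (h : IsUnit (A : Matrix (Fin 2) (Fin 2) ℤ).det) :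
    cls (A : Matrix (Fin 2) (Fin 2) ℤ) h = ofSL A := by
  unfold cls
  exact congrArg _ (Units.ext rfl)

lemma cls_mul_cls (A B : Matrix (Fin 2) (Fin 2) ℤ) (hA : IsUnit A.det) (hB : IsUnit B.det) :
    cls A hA * cls B hB = cls (A * B) (by rw [det_mul]; exact hA.mul hB) := by
  unfold cls
  rw [← map_mul]
  exact congrArg _ (Units.ext rfl)

lemma ofSL_neg (A : SL(2, ℤ)) : ofSL (-A) = ofSL A := by
  refine (ProjGenLinGroup.mk_eq_mk_iff).2 ⟨-1, Units.ext ?_⟩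
  ext i j
  fin_cases i <;> fin_cases j <;> simp [Matrix.mul_apply, Fin.sum_univ_two]

lemma Gam_eq_range : Gam = ofSL.range := by
  ext g
  constructor
  · rintro ⟨x, rfl⟩
    induction x using QuotientGroup.induction_on with
    | H A => exact ⟨A, rfl⟩
  · rintro ⟨A, rfl⟩
    exact ⟨QuotientGroup.mk A, rfl⟩

lemma ofSL_mem_Gam (A : SL(2, ℤ)) : ofSL A ∈ Gam := Gam_eq_range ▸ ⟨A, rfl⟩

/-- The matrix `(a b; c d)` of determinant one. -/
def sl (a b c d : ℤ) (h : a * d - b * c = 1) : SL(2, ℤ) :=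
  ⟨!![a, b; c, d], by rw [det_fin_two_of, h]⟩

lemma sl_congr {a b c d a' b' c' d' : ℤ} {h : a * d - b * c = 1} {h' : a' * d' - b' * c' = 1}
    (ha : a = a') (hb : b = b') (hc : c = c') (hd : d = d') :
    sl a b c d h = sl a' b' c' d' h' := by
  subst ha hb hc hd; rfl

lemma sl_mul (a b c d a' b' c' d' : ℤ) (h : a * d - b * c = 1) (h' : a' * d' - b' * c' = 1) :
    sl a b c d h * sl a' b' c' d' h' =
      sl (a * a' + b * c') (a * b' + b * d') (c * a' + d * c') (c * b' + d * d')
        (by linear_combination (a' * d' - b' * c') * h + h') := by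
  apply Subtype.ext
  exact Matrix.mul_fin_two ..

lemma sl_neg (a b c d : ℤ) (h : a * d - b * c = 1) :
    -sl a b c d h = sl (-a) (-b) (-c) (-d) (by linear_combination h) := by
  apply Subtype.ext
  rw [SpecialLinearGroup.coe_neg]
  simp [sl]

lemma sl_one : sl 1 0 0 1 (by norm_num) = 1 := by
  apply Subtype.ext
  simp [sl, Matrix.one_fin_two]

lemma sl_inv (a b c d : ℤ) (h : a * d - b * c = 1) :
    (sl a b c d h)⁻¹ = sl d (-b) (-c) a (by linear_combination h) := by
  rw [inv_eq_iff_mul_eq_one, sl_mul, ← sl_one]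
  exact sl_congr (by linear_combination h) (by ring) (by ring) (by linear_combination h)

lemma L_eq : L = ofSL (sl 1 0 1 1 (by norm_num)) := cls_eq_ofSL (sl 1 0 1 1 (by norm_num)) _
lemma N_eq : N = ofSL (sl 1 1 0 1 (by norm_num)) := cls_eq_ofSL (sl 1 1 0 1 (by norm_num)) _
lemma S_eq : S = ofSL (sl 0 (-1) 1 0 (by norm_num)) :=
  cls_eq_ofSL (sl 0 (-1) 1 0 (by norm_num)) _
lemma R_eq : R = ofSL (sl 1 (-1) 1 0 (by norm_num)) :=
  cls_eq_ofSL (sl 1 (-1) 1 0 (by norm_num)) _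

lemma S_mul_S : S * S = 1 := by
  rw [S_eq, ← map_mul, sl_mul, ← ofSL_neg, sl_neg, ← map_one ofSL, ← sl_one]
  congr 1

lemma R_pow_three : R ^ 3 = 1 := by
  rw [R_eq, pow_three, ← map_mul, ← map_mul, sl_mul, sl_mul, ← ofSL_neg, sl_neg,
    ← map_one ofSL, ← sl_one]
  congr 1

lemma N_eq_R_mul_S : N = R * S := by
  rw [R_eq, S_eq, N_eq, ← map_mul, sl_mul, ← ofSL_neg, sl_neg]
  congr 1

/-! ### Cosets of ⟨R, SRS⟩ in Γ -/

lemma Gam_eq_closure : Gam = Subgroup.closure {S, N} := by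
  have h := congrArg (Subgroup.map ofSL) SpecialLinearGroup.SL2Z_generators
  rw [MonoidHom.map_closure, ← MonoidHom.range_eq_map, ← Gam_eq_range] at h
  rw [← h, Set.image_pair, S_eq, N_eq]
  rfl

lemma R_mem_RSRS : R ∈ RSRS := Subgroup.subset_closure (by simp)

lemma SRS_mem_RSRS : S * R * S ∈ RSRS := Subgroup.subset_closure (by simp)

lemma S_mem_Gam : S ∈ Gam := S_eq ▸ ofSL_mem_Gam _

lemma R_mem_Gam : R ∈ Gam := R_eq ▸ ofSL_mem_Gam _

lemma RSRS_le_iff {H : Subgroup PG} : RSRS ≤ H ↔ R ∈ H ∧ S * R * S ∈ H := by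
  rw [RSRS, Subgroup.closure_le, Set.pair_subset_iff]
  rfl

lemma RSRS_le_Gam : RSRS ≤ Gam :=
  RSRS_le_iff.2 ⟨R_mem_Gam, mul_mem (mul_mem S_mem_Gam R_mem_Gam) S_mem_Gam⟩

lemma S_inv : S⁻¹ = S := inv_eq_of_mul_eq_one_left S_mul_S

/-- Induction on words in `S` and `N = RS`: left multiplication by `S` swaps the two alternatives,
and so does left multiplication by `N`, because `S · N · y = SRS · y` and `N · y = R · (S · y)`. -/
lemma mem_RSRS_or_S_mul_mem {g : PG} (hg : g ∈ Gam) : g ∈ RSRS ∨ S * g ∈ RSRS := by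
  rw [Gam_eq_closure] at hg
  have hS : ∀ g, g ∈ RSRS ∨ S * g ∈ RSRS → S * g ∈ RSRS ∨ S * (S * g) ∈ RSRS := by
    intro g h
    rw [← mul_assoc, S_mul_S, one_mul]
    exact h.symm
  induction hg using Subgroup.closure_induction_left with
  | one => exact .inl (one_mem _)
  | mul_left x hx y _ ih =>
    rcases hx with rfl | rfl
    · exact hS y ih
    · rw [N_eq_R_mul_S]
      rcases ih with ih | ih
      · exact .inr (by simpa [mul_assoc] using mul_mem SRS_mem_RSRS ih)
      · exact .inl (by simpa [mul_assoc] using mul_mem R_mem_RSRS ih)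
  | inv_mul_cancel x hx y _ ih =>
    rcases hx with rfl | rfl
    · rw [S_inv]; exact hS y ih
    · have hN : N⁻¹ = S * R⁻¹ := by rw [N_eq_R_mul_S, _root_.mul_inv_rev, S_inv]
      rw [hN]
      rcases ih with ih | ih
      · refine .inr ?_
        rw [mul_assoc, ← mul_assoc S S, S_mul_S, one_mul]
        exact mul_mem (inv_mem R_mem_RSRS) ih
      · refine .inl ?_
        have := mul_mem (inv_mem SRS_mem_RSRS) ih
        rw [_root_.mul_inv_rev, _root_.mul_inv_rev, S_inv] at this
        simpa [mul_assoc, ← mul_assoc S S, S_mul_S] using this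

lemma eq_Gam_or_eq_RSRS {H : Subgroup PG} (h : RSRS ≤ H) (hH : H ≤ Gam) : H = Gam ∨ H = RSRS := by
  by_cases hS : S ∈ H
  · refine .inl (le_antisymm hH fun g hg ↦ ?_)
    rcases mem_RSRS_or_S_mul_mem hg with h' | h'
    · exact h h'
    · exact (Subgroup.mul_mem_cancel_left H hS).1 (h h')
  · refine .inr (le_antisymm (fun g hg ↦ ?_) h)
    rcases mem_RSRS_or_S_mul_mem (hH hg) with h' | h'
    · exact h'
    · exact absurd ((Subgroup.mul_mem_cancel_right H hg).1 (h h')) hS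

/-! ### The sign character and the uniqueness of the index-2 subgroup -/

/-- The quadratic form `ab + bc + cd` over `𝔽₂`, which on `GL₂(𝔽₂)` is the sign of the permutation
of the three nonzero vectors. -/
def parityForm (a b c d : ZMod 2) : ZMod 2 := a * b + b * c + c * d

lemma parityForm_mul (a b c d a' b' c' d' : ZMod 2) (h : a * d - b * c = 1)
    (h' : a' * d' - b' * c' = 1) :
    parityForm (a * a' + b * c') (a * b' + b * d') (c * a' + d * c') (c * b' + d * d') =
      parityForm a b c d + parityForm a' b' c' d' := by
  revert a b c d a' b' c' d'
  decide

/-- Determinants 1 and −1 agree modulo 2, so the sign is available on all of GL₂(ℤ). -/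
lemma det_cast_zmod_two (M : GL (Fin 2) ℤ) :
    (M 0 0 : ZMod 2) * (M 1 1 : ZMod 2) - (M 0 1 : ZMod 2) * (M 1 0 : ZMod 2) = 1 := by
  have h : IsUnit (M : Matrix (Fin 2) (Fin 2) ℤ).det := by
    simp
  rw [det_fin_two] at h
  have h2 : IsUnit (((M 0 0 * M 1 1 - M 0 1 * M 1 0 : ℤ) : ZMod 2)) :=
    h.map (Int.castRingHom (ZMod 2))
  push_cast at h2
  generalize (M 0 0 : ZMod 2) * (M 1 1 : ZMod 2) - (M 0 1 : ZMod 2) * (M 1 0 : ZMod 2) = z at h2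
  revert z
  decide

/-- The homomorphism `GL₂(ℤ) → GL₂(𝔽₂) → ℤ/2` given by the sign. -/
def parityGL : GL (Fin 2) ℤ →* Multiplicative (ZMod 2) where
  toFun M := Multiplicative.ofAdd (parityForm (M 0 0) (M 0 1) (M 1 0) (M 1 1))
  map_one' := by simp [parityForm]
  map_mul' M M' := by
    rw [← ofAdd_add, ← parityForm_mul _ _ _ _ _ _ _ _ (det_cast_zmod_two M)
      (det_cast_zmod_two M')]
    simp [Matrix.mul_apply, Fin.sum_univ_two]

/-- The sign homomorphism on `PGL₂(ℤ)`. -/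
def parity : PG →* Multiplicative (ZMod 2) :=
  QuotientGroup.lift (Subgroup.center (GL (Fin 2) ℤ)) parityGL fun M hM ↦ by
    rw [GeneralLinearGroup.center_eq_range_scalar] at hM
    obtain ⟨u, rfl⟩ := hM
    have h01 : (GeneralLinearGroup.scalar (Fin 2) u) 0 1 = 0 := rfl
    have h10 : (GeneralLinearGroup.scalar (Fin 2) u) 1 0 = 0 := rfl
    change Multiplicative.ofAdd (parityForm _ _ _ _) = 1
    rw [h01, h10]
    simp [parityForm]

lemma parity_ofSL (a b c d : ℤ) (h : a * d - b * c = 1) :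
    parity (ofSL (sl a b c d h)) = Multiplicative.ofAdd (parityForm a b c d) := rfl

lemma parity_L : parity L = Multiplicative.ofAdd 1 := by
  rw [L_eq, parity_ofSL]; simp [parityForm]

lemma parity_N : parity N = Multiplicative.ofAdd 1 := by
  rw [N_eq, parity_ofSL]; simp [parityForm]

lemma parity_S : parity S = Multiplicative.ofAdd 1 := by
  rw [S_eq, parity_ofSL]; simp [parityForm]

lemma parity_R : parity R = 1 := by
  rw [R_eq, parity_ofSL]; rfl

lemma ofAdd_one_ne_one : (Multiplicative.ofAdd (1 : ZMod 2)) ≠ 1 := by decide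

lemma RSRS_le_ker_parity : RSRS ≤ parity.ker := by
  refine RSRS_le_iff.2 ⟨parity_R, ?_⟩
  rw [MonoidHom.mem_ker, map_mul, map_mul, parity_R, parity_S]
  decide

lemma S_notMem_RSRS : S ∉ RSRS := fun h ↦ by
  have := RSRS_le_ker_parity h
  rw [MonoidHom.mem_ker, parity_S] at this
  exact ofAdd_one_ne_one this

lemma relIndex_RSRS_Gam : RSRS.relIndex Gam = 2 :=
  Subgroup.relIndex_eq_two_iff_exists_notMem_and'.2
    ⟨S, S_mem_Gam, S_notMem_RSRS, fun _ hg ↦ (mem_RSRS_or_S_mul_mem hg).symm⟩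

/-- Squares lie in a subgroup of index 2, and `g = g⁴` is a square. -/
lemma mem_of_pow_three_of_relIndex_eq_two {G : Type*} [Group G] {H K : Subgroup G}
    (h : H.relIndex K = 2) {g : G} (hg : g ∈ K) (h3 : g ^ 3 = 1) : g ∈ H := by
  have h2 := Subgroup.sq_mem_of_index_two (H := H.subgroupOf K) h ((⟨g, hg⟩ : K) ^ 2)
  rw [Subgroup.mem_subgroupOf] at h2
  have h4 : (g ^ 2) ^ 2 = g := by
    rw [← pow_mul, show 2 * 2 = 3 + 1 from rfl, pow_succ, h3, one_mul]
  simpa [h4] using h2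

lemma eq_RSRS_of_relIndex_eq_two {H : Subgroup PG} (hH : H ≤ Gam) (h : H.relIndex Gam = 2) :
    H = RSRS := by
  have hR : R ∈ H := mem_of_pow_three_of_relIndex_eq_two h R_mem_Gam R_pow_three
  have hSRS : S * R * S ∈ H := by
    refine mem_of_pow_three_of_relIndex_eq_two h (RSRS_le_Gam SRS_mem_RSRS) ?_
    have : S * R * S = S * R * S⁻¹ := by rw [S_inv]
    rw [this, conj_pow, R_pow_three]
    simp
  refine (eq_Gam_or_eq_RSRS (RSRS_le_iff.2 ⟨hR, hSRS⟩) hH).resolve_left ?_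
  rintro rfl
  simp at h

/-! ### Words in L and N -/

/-- Nonnegative matrices of determinant one are products of the matrices defining `L` and `N`. -/
lemma exists_LN_word (s : ℕ) : ∀ (a b c d : ℕ) (h : (a : ℤ) * d - b * c = 1),
    a + b + c + d = s →
      ∃ w : List PG, (∀ B ∈ w, B = L ∨ B = N) ∧ w.prod = ofSL (sl a b c d h) := by
  induction s using Nat.strong_induction_on with
  | _ s ih =>
  intro a b c d h hs
  have ha : 0 < a := by
    rcases Nat.eq_zero_or_pos a with rfl | ha
    · push_cast at h; nlinarith
    · exact ha
  have hd : 0 < d := by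
    rcases Nat.eq_zero_or_pos d with rfl | hd
    · push_cast at h; nlinarith
    · exact hd
  by_cases h1 : c ≤ a ∧ d ≤ b
  · obtain ⟨⟨k, rfl⟩, ⟨l, rfl⟩⟩ := And.imp Nat.exists_eq_add_of_le Nat.exists_eq_add_of_le h1
    have h' : (k : ℤ) * d - l * c = 1 := by push_cast at h; linarith
    obtain ⟨w, hw, hw'⟩ := ih (k + l + c + d) (by omega) k l c d h' rfl
    refine ⟨N :: w, by simpa using hw, ?_⟩
    rw [List.prod_cons, hw', N_eq, ← map_mul, sl_mul]
    exact congrArg _ (sl_congr (by push_cast; ring) (by push_cast; ring) (by ring) (by ring))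
  by_cases h2 : a ≤ c ∧ b ≤ d
  · obtain ⟨⟨k, rfl⟩, ⟨l, rfl⟩⟩ := And.imp Nat.exists_eq_add_of_le Nat.exists_eq_add_of_le h2
    have h' : (a : ℤ) * l - b * k = 1 := by push_cast at h; linarith
    obtain ⟨w, hw, hw'⟩ := ih (a + b + k + l) (by omega) a b k l h' rfl
    refine ⟨L :: w, by simpa using hw, ?_⟩
    rw [List.prod_cons, hw', L_eq, ← map_mul, sl_mul]
    exact congrArg _ (sl_congr (by ring) (by ring) (by push_cast; ring) (by push_cast; ring))
  -- Neither row dominates the other. The crossing `a ≤ c`, `d < b` would make the determinant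
  -- negative; the other one gives `ad − bc ≥ b + c + 1`, which leaves only the identity matrix.
  have hlt : c < a ∧ b < d := by
    have key : c < a → b < d := by
      intro hca
      by_contra! hbd
      exact h1 ⟨hca.le, hbd⟩
    by_cases hca : c < a
    · exact ⟨hca, key hca⟩
    · exfalso
      push Not at hca
      have hdb : d < b := by
        by_contra! hbd
        exact h2 ⟨hca, hbd⟩
      zify at hca hdb ha hd
      nlinarith
  obtain ⟨hca, hbd⟩ := hlt
  have hc0 : c = 0 := by zify at *; nlinarith
  subst hc0
  have had : a * d = 1 := by zify; simpa using h
  obtain ⟨rfl, rfl⟩ := mul_eq_one.1 had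
  obtain rfl : b = 0 := by omega
  exact ⟨[], by simp, by rw [List.prod_nil, ← map_one ofSL, ← sl_one]; rfl⟩

lemma parity_prod {w : List PG} (hw : ∀ B ∈ w, B = L ∨ B = N) :
    parity w.prod = Multiplicative.ofAdd (w.length : ZMod 2) := by
  induction w with
  | nil => simp
  | cons B w ih =>
    rw [List.prod_cons, map_mul, ih fun C hC ↦ hw C (List.mem_cons_of_mem _ hC)]
    have hB : parity B = Multiplicative.ofAdd 1 := by
      rcases hw B List.mem_cons_self with rfl | rfl
      exacts [parity_L, parity_N]
    rw [hB, ← ofAdd_add, List.length_cons, Nat.cast_succ, add_comm]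

lemma parity_ne_one_of_isOddLNProduct {A : PG} (h : IsOddLNProduct A) : parity A ≠ 1 := by
  obtain ⟨w, hw, ho, rfl⟩ := h
  rw [parity_prod hw, ZMod.natCast_eq_one_iff_odd.2 ho]
  exact ofAdd_one_ne_one

lemma isOddLNProduct_of_parity_ne_one {a b c d : ℕ} (h : (a : ℤ) * d - b * c = 1)
    (hp : parity (ofSL (sl a b c d h)) ≠ 1) : IsOddLNProduct (ofSL (sl a b c d h)) := by
  obtain ⟨w, hw, hw'⟩ := exists_LN_word _ a b c d h rfl
  refine ⟨w, hw, ?_, hw'⟩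
  by_contra ho
  rw [Nat.not_odd_iff_even] at ho
  rw [← hw', parity_prod hw, ZMod.natCast_eq_zero_iff_even.2 ho] at hp
  exact hp rfl

end SlowCF

/-! ### Unimodular intervals and monotonicity of the branches -/

namespace SlowCF

open Matrix MatrixGroups
open scoped ENNReal NNReal

lemma coe_div_le_coe_div_iff {a b c d : ℝ≥0} (hab : a ≠ 0 ∨ b ≠ 0) (hcd : c ≠ 0 ∨ d ≠ 0) :
    (a : ℝ≥0∞) / b ≤ c / d ↔ a * d ≤ c * b := by
  rcases eq_or_ne d 0 with rfl | hd
  · have hc : c ≠ 0 := by simpa using hcd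
    simp [ENNReal.div_zero, hc]
  rcases eq_or_ne b 0 with rfl | hb
  · have ha : a ≠ 0 := by simpa using hab
    have : (c : ℝ≥0∞) / d ≠ ⊤ := ENNReal.div_ne_top ENNReal.coe_ne_top (by simpa using hd)
    simp [ENNReal.div_zero, ha, hd, this]
  · rw [← ENNReal.coe_div hb, ← ENNReal.coe_div hd, ENNReal.coe_le_coe,
      div_le_div_iff₀ (pos_iff_ne_zero.2 hb) (pos_iff_ne_zero.2 hd)]

lemma coe_div_lt_coe_div_iff {a b c d : ℝ≥0} (hab : a ≠ 0 ∨ b ≠ 0) (hcd : c ≠ 0 ∨ d ≠ 0) :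
    (a : ℝ≥0∞) / b < c / d ↔ a * d < c * b := by
  rw [← not_le, coe_div_le_coe_div_iff hcd hab, not_le]

lemma natCast_div_le_natCast_div_iff {a b c d : ℕ} (hab : a ≠ 0 ∨ b ≠ 0) (hcd : c ≠ 0 ∨ d ≠ 0) :
    (a : ℝ≥0∞) / b ≤ c / d ↔ a * d ≤ c * b := by
  have := coe_div_le_coe_div_iff (a := a) (b := b) (c := c) (d := d)
    (by simpa using hab) (by simpa using hcd)
  exact_mod_cast this

namespace UnimodularInterval

variable (I : UnimodularInterval)

lemma left_ne : I.p ≠ 0 ∨ I.q ≠ 0 := by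
  by_contra! h
  have := I.det_eq
  simp [h.1, h.2] at this

lemma right_ne : I.p' ≠ 0 ∨ I.q' ≠ 0 := by
  by_contra! h
  have := I.det_eq
  simp [h.1, h.2] at this

lemma left_lt_right : I.left < I.right := by
  rw [← not_le, right, left, natCast_div_le_natCast_div_iff I.right_ne I.left_ne, not_le]
  have := I.det_eq
  zify
  omega

lemma det_swap : (I.p' : ℤ) * I.q - I.p * I.q' = 1 := by
  linarith [I.det_eq]

lemma coprime_left : I.p.Coprime I.q := by
  rw [← Nat.isCoprime_iff_coprime]
  exact ⟨-I.q', I.p', by linarith [I.det_eq]⟩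

lemma coprime_right : I.p'.Coprime I.q' := by
  rw [← Nat.isCoprime_iff_coprime]
  exact ⟨I.q, -I.p, by linarith [I.det_eq]⟩

end UnimodularInterval

lemma eq_of_coprime_of_mul_eq {a b c d : ℕ} (hab : a.Coprime b) (hcd : c.Coprime d)
    (h : a * d = c * b) : a = c ∧ b = d := by
  refine ⟨Nat.dvd_antisymm ?_ ?_, Nat.dvd_antisymm ?_ ?_⟩
  · exact hab.dvd_of_dvd_mul_right (Dvd.intro _ h)
  · exact hcd.dvd_of_dvd_mul_right (Dvd.intro _ h.symm)
  · exact hab.symm.dvd_of_dvd_mul_left (Dvd.intro_left c h.symm)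
  · exact hcd.symm.dvd_of_dvd_mul_left (Dvd.intro_left a h)

lemma eq_of_natCast_div_eq {a b c d : ℕ} (hab : a.Coprime b) (hcd : c.Coprime d)
    (hab0 : a ≠ 0 ∨ b ≠ 0) (hcd0 : c ≠ 0 ∨ d ≠ 0)
    (h : (a : ℝ≥0∞) / b = c / d) : a = c ∧ b = d :=
  eq_of_coprime_of_mul_eq hab hcd <| le_antisymm
    ((natCast_div_le_natCast_div_iff hab0 hcd0).1 h.le)
    ((natCast_div_le_natCast_div_iff hcd0 hab0).1 h.ge)

lemma eq_or_eq_neg_of_mk_eq {M M' : GL (Fin 2) ℤ} (h : ProjGenLinGroup.mk M = ProjGenLinGroup.mk M') :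
    M = M' ∨ M' = -M := by
  obtain ⟨u, rfl⟩ := ProjGenLinGroup.mk_eq_mk_iff.1 h
  rcases Int.units_eq_one_or u with rfl | rfl
  · left; simp
  · right
    apply Units.ext
    ext i j
    fin_cases i <;> fin_cases j <;> simp [Matrix.mul_apply, Fin.sum_univ_two]

/-- The matrix `(p p'; q q')` as a unit. -/
noncomputable def UnimodularInterval.mat (I : UnimodularInterval) : GL (Fin 2) ℤ :=
  GeneralLinearGroup.mk'' !![(I.p : ℤ), (I.p' : ℤ); (I.q : ℤ), (I.q' : ℤ)] (by
    rw [Matrix.det_fin_two_of, I.det_eq]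
    exact isUnit_one.neg)

namespace SlowAlgorithm

variable (T : SlowAlgorithm)

lemma branch_of_one {a : Fin T.n} (h : T.e a = 1) :
    T.branch a = ofSL (sl (T.Δ a).p' (T.Δ a).p (T.Δ a).q' (T.Δ a).q (T.Δ a).det_swap) := by
  have hF : F * F = 1 := by
    rw [F, cls_mul_cls, ← map_one ofSL, ← cls_eq_ofSL 1 (by simp)]
    congr 1
    simp [Matrix.one_fin_two]
  rw [branch, h, Units.val_one, show ((1 : ℤ) + 1) / 2 = 1 from rfl, zpow_one, _root_.mul_inv_rev,
    inv_inv, inv_eq_of_mul_eq_one_left hF, UnimodularInterval.elt, F, cls_mul_cls,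
    ← cls_eq_ofSL _ (by simp)]
  congr 1
  simp [sl]

lemma branch_of_neg_one {a : Fin T.n} (h : T.e a = -1) : T.branch a = (T.Δ a).elt := by
  rw [branch, h, Units.val_neg, Units.val_one]
  simp

lemma posDet_ofSL (A : SL(2, ℤ)) : PosDet (ofSL A) := ⟨A, rfl, by simp⟩

lemma not_posDet_elt (I : UnimodularInterval) : ¬ PosDet I.elt := by
  rintro ⟨M, hM, hpos⟩
  have hdet : (I.mat : Matrix (Fin 2) (Fin 2) ℤ).det = -1 := by
    change (!![(I.p : ℤ), (I.p' : ℤ); (I.q : ℤ), (I.q' : ℤ)]).det = -1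
    rw [det_fin_two_of, I.det_eq]
  rcases eq_or_eq_neg_of_mk_eq (M' := I.mat) hM with rfl | h
  · omega
  · rw [h, Units.val_neg, det_neg] at hdet
    simp at hdet
    omega

lemma posDet_branch_iff (a : Fin T.n) : PosDet (T.branch a) ↔ T.e a = 1 := by
  rcases Int.units_eq_one_or (T.e a) with h | h
  · rw [T.branch_of_one h]
    exact iff_of_true (posDet_ofSL _) h
  · rw [T.branch_of_neg_one h, h]
    exact iff_of_false (not_posDet_elt _) (by decide)

variable {T} in
/-- On its interval an orientation-preserving branch is given, in nonnegative homogeneous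
coordinates, by the matrix `(q -p; -q' p')`. -/
lemma GraphOn.exists_coordinates {a : Fin T.n} (he : T.e a = 1) {x y : ℝ≥0∞}
    (h : T.GraphOn a x y) : ∃ u v u' v' : ℝ≥0, (u ≠ 0 ∨ v ≠ 0) ∧ (u' ≠ 0 ∨ v' ≠ 0) ∧
      x = (u : ℝ≥0∞) / (v : ℝ≥0∞) ∧ y = (u' : ℝ≥0∞) / (v' : ℝ≥0∞) ∧
      ((T.Δ a).q : ℝ) * u - (T.Δ a).p * v = u' ∧ (T.Δ a).p' * v - (T.Δ a).q' * u = (v' : ℝ) := by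
  obtain ⟨⟨hl, hr⟩, M, u, v, u', v', hM, huv, huv', rfl, rfl, h1, h2⟩ := h
  refine ⟨u, v, u', v', huv, huv', rfl, rfl, ?_⟩
  have hl' := (coe_div_le_coe_div_iff (a := (T.Δ a).p) (b := (T.Δ a).q)
    (by simpa using (T.Δ a).left_ne) huv).1 hl
  have hr' := (coe_div_le_coe_div_iff (c := (T.Δ a).p') (d := (T.Δ a).q')
    huv (by simpa using (T.Δ a).right_ne)).1 hr
  rw [← NNReal.coe_le_coe] at hl' hr'
  push_cast at hl' hr'
  rw [T.branch_of_one he, ← map_inv, sl_inv] at hM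
  rcases eq_or_eq_neg_of_mk_eq hM with rfl | hM'
  · change (((T.Δ a).q : ℤ) : ℝ) * u + ((-(T.Δ a).p : ℤ) : ℝ) * v = u' at h1
    change ((-(T.Δ a).q' : ℤ) : ℝ) * u + (((T.Δ a).p' : ℤ) : ℝ) * v = v' at h2
    push_cast at h1 h2
    constructor <;> linarith
  -- With the opposite sign of the matrix both image coordinates would be nonpositive on `Δ_a`,
  -- hence zero, which represents no point.
  · exfalso
    have hval (i j : Fin 2) : M i j = -(!![((T.Δ a).q : ℤ), -(T.Δ a).p;
        -(T.Δ a).q', (T.Δ a).p'] i j) := by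
      have := congrArg (fun A : GL (Fin 2) ℤ ↦ -A i j) hM'
      simp only [Units.val_neg, Matrix.neg_apply, neg_neg] at this
      exact this.symm
    rw [hval, hval] at h1 h2
    simp at h1 h2
    have hu' : u' = 0 := NNReal.coe_eq_zero.1 (le_antisymm (by linarith) u'.coe_nonneg)
    have hv' : v' = 0 := NNReal.coe_eq_zero.1 (le_antisymm (by linarith) v'.coe_nonneg)
    simp [hu', hv'] at huv'

/-- The order of two points is the sign of `u₂v₁ − u₁v₂`, which a matrix multiplies by its
determinant, here 1. -/
lemma increasingOn_of_one {a : Fin T.n} (he : T.e a = 1) : T.IncreasingOn a := by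
  intro x₁ x₂ y₁ y₂ h₁ h₂ hlt
  obtain ⟨u₁, v₁, u₁', v₁', hn₁, hn₁', rfl, rfl, hu₁, hv₁⟩ := h₁.exists_coordinates he
  obtain ⟨u₂, v₂, u₂', v₂', hn₂, hn₂', rfl, rfl, hu₂, hv₂⟩ := h₂.exists_coordinates he
  rw [coe_div_lt_coe_div_iff hn₁ hn₂, ← NNReal.coe_lt_coe] at hlt
  rw [coe_div_lt_coe_div_iff hn₁' hn₂', ← NNReal.coe_lt_coe]
  push_cast at hlt ⊢
  have hdet : ((T.Δ a).p' : ℝ) * (T.Δ a).q - (T.Δ a).p * (T.Δ a).q' = 1 := by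
    exact_mod_cast (T.Δ a).det_swap
  rw [← sub_pos] at hlt ⊢
  calc (0 : ℝ) < (u₂ : ℝ) * v₁ - u₁ * v₂ := hlt
    _ = _ := by
      rw [← hu₁, ← hu₂, ← hv₁, ← hv₂]
      linear_combination (-((u₂ : ℝ) * v₁ - u₁ * v₂)) * hdet

lemma not_increasingOn_of_neg_one {a : Fin T.n} (he : T.e a = -1) : ¬ T.IncreasingOn a := by
  intro h
  set I := T.Δ a with hI
  have hu : IsUnit (!![-(I.q' : ℤ), (I.p' : ℤ); (I.q : ℤ), -(I.p : ℤ)]).det := by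
    rw [det_fin_two_of, show -(I.q' : ℤ) * -I.p - I.p' * I.q = -1 by linarith [I.det_eq]]
    exact isUnit_one.neg
  have hcls : ProjGenLinGroup.mk (GeneralLinearGroup.mk'' _ hu) = (T.branch a)⁻¹ := by
    rw [T.branch_of_neg_one he]
    refine eq_inv_of_mul_eq_one_right ?_
    change I.elt * cls _ hu = 1
    rw [UnimodularInterval.elt, cls_mul_cls, ← map_one ofSL, ← cls_eq_ofSL 1 (by simp)]
    congr 1
    rw [Matrix.mul_fin_two]
    refine Eq.trans ?_ Matrix.one_fin_two.symm
    congr 1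
    ext i j
    fin_cases i <;> fin_cases j <;> simp <;> linarith [I.det_eq]
  have hdet : ((I.p' : ℝ)) * I.q - I.p * I.q' = 1 := by exact_mod_cast I.det_swap
  -- The inverse branch sends the vectors of the left and right endpoints to (1, 0) and (0, 1), so
  -- these endpoints go to ∞ and 0, in the wrong order.
  have hlt := h I.left I.right ⊤ 0
    ⟨⟨le_rfl, I.left_lt_right.le⟩, _, I.p, I.q, 1, 0, hcls, by simpa using I.left_ne, by simp,
      by simp [UnimodularInterval.left], by simp, ?_, ?_⟩
    ⟨⟨I.left_lt_right.le, le_rfl⟩, _, I.p', I.q', 0, 1, hcls, by simpa using I.right_ne, by simp,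
      by simp [UnimodularInterval.right], by simp, ?_, ?_⟩ I.left_lt_right
  · simp at hlt
  all_goals
    simp [GeneralLinearGroup.mk'', nonsingInvUnit]
    linarith

lemma increasingOn_iff (a : Fin T.n) : T.IncreasingOn a ↔ T.e a = 1 := by
  refine ⟨fun h ↦ ?_, T.increasingOn_of_one⟩
  rcases Int.units_eq_one_or (T.e a) with he | he
  · exact he
  · exact absurd h (T.not_increasingOn_of_neg_one he)

/-! ### The partition as a Farey path -/

lemma right_eq_left_succ {a b : Fin T.n} (hab : (b : ℕ) = a + 1) :
    (T.Δ a).right = (T.Δ b).left := by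
  -- A point in a gap between the two intervals would be covered by no interval.
  refine le_antisymm (T.sorted a b (Fin.lt_def.2 (by omega))) ?_
  by_contra! hlt
  obtain ⟨x, hx₁, hx₂⟩ := exists_between hlt
  obtain ⟨c, hc₁, hc₂⟩ := Set.mem_iUnion.1 (T.cover ▸ Set.mem_univ x)
  rcases lt_trichotomy c a with h | rfl | h
  · exact absurd (hc₂.trans ((T.sorted c a h).trans (T.Δ a).left_lt_right.le)) (not_le.2 hx₁)
  · exact absurd hc₂ (not_le.2 hx₁)
  · have hbc : b ≤ c := Fin.le_def.2 (by have := Fin.lt_def.1 h; omega)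
    rcases hbc.eq_or_lt with rfl | hbc
    · exact absurd hc₁ (not_le.2 hx₂)
    · exact absurd (((T.Δ b).left_lt_right.le.trans (T.sorted b c hbc)).trans hc₁) (not_le.2 hx₂)

lemma left_eq_zero {a : Fin T.n} (ha : (a : ℕ) = 0) : (T.Δ a).left = 0 := by
  obtain ⟨c, hc, -⟩ := Set.mem_iUnion.1 (T.cover ▸ Set.mem_univ (0 : ℝ≥0∞))
  rw [nonpos_iff_eq_zero] at hc
  rcases eq_or_ne a c with rfl | hne
  · exact hc
  · have hac : a < c := Fin.lt_def.2 (by have := Fin.val_ne_of_ne hne; omega)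
    have := (T.sorted a c hac).trans hc.le
    exact absurd ((T.Δ a).left_lt_right.trans_le this) not_lt_zero

lemma right_eq_top {a : Fin T.n} (ha : (a : ℕ) + 1 = T.n) : (T.Δ a).right = ⊤ := by
  obtain ⟨c, -, hc⟩ := Set.mem_iUnion.1 (T.cover ▸ Set.mem_univ (⊤ : ℝ≥0∞))
  rw [top_le_iff] at hc
  rcases eq_or_ne c a with rfl | hne
  · exact hc
  · have hca : c < a := Fin.lt_def.2 (by have := Fin.val_ne_of_ne hne; omega)
    have := hc.ge.trans (T.sorted c a hca)
    exact absurd (this.trans_lt (T.Δ a).left_lt_right) not_top_lt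

lemma right_coord_eq_left_coord {a b : Fin T.n} (hab : (b : ℕ) = a + 1) :
    (T.Δ a).p' = (T.Δ b).p ∧ (T.Δ a).q' = (T.Δ b).q :=
  eq_of_natCast_div_eq (T.Δ a).coprime_right (T.Δ b).coprime_left (T.Δ a).right_ne
    (T.Δ b).left_ne (T.right_eq_left_succ hab)

lemma left_coord_zero {a : Fin T.n} (ha : (a : ℕ) = 0) : (T.Δ a).p = 0 ∧ (T.Δ a).q = 1 :=
  eq_of_natCast_div_eq (T.Δ a).coprime_left (by simp) (T.Δ a).left_ne
    (by simp) (by simpa [UnimodularInterval.left] using T.left_eq_zero ha)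

lemma right_coord_last {a : Fin T.n} (ha : (a : ℕ) + 1 = T.n) :
    (T.Δ a).p' = 1 ∧ (T.Δ a).q' = 0 :=
  eq_of_natCast_div_eq (T.Δ a).coprime_right (by simp) (T.Δ a).right_ne
    (by simp) (by simpa [UnimodularInterval.right, ENNReal.div_zero] using T.right_eq_top ha)

/-- The numerators of the endpoints of the partition. -/
def num (i : ℕ) : ℕ := if h : i < T.n then (T.Δ ⟨i, h⟩).p else 1

/-- The denominators of the endpoints of the partition. -/
def den (i : ℕ) : ℕ := if h : i < T.n then (T.Δ ⟨i, h⟩).q else 0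

lemma num_zero : T.num 0 = 0 := by
  have := T.two_le
  rw [num, dif_pos (by omega)]
  exact (T.left_coord_zero rfl).1

lemma den_zero : T.den 0 = 1 := by
  have := T.two_le
  rw [den, dif_pos (by omega)]
  exact (T.left_coord_zero rfl).2

lemma num_n : T.num T.n = 1 := by simp [num]

lemma den_n : T.den T.n = 0 := by simp [den]

lemma num_val (a : Fin T.n) : T.num a = (T.Δ a).p := by simp [num]

lemma den_val (a : Fin T.n) : T.den a = (T.Δ a).q := by simp [den]

/-- For the last interval this rests on the default value 1/0 = ∞ of `num` and `den` at index `n`.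
-/
lemma num_den_val_succ (a : Fin T.n) :
    T.num (a + 1) = (T.Δ a).p' ∧ T.den (a + 1) = (T.Δ a).q' := by
  by_cases h : (a : ℕ) + 1 < T.n
  · rw [num, den, dif_pos h, dif_pos h]
    have := T.right_coord_eq_left_coord (a := a) (b := ⟨a + 1, h⟩) rfl
    exact ⟨this.1.symm, this.2.symm⟩
  · rw [num, den, dif_neg h, dif_neg h]
    have := T.right_coord_last (a := a) (by omega)
    exact ⟨this.1.symm, this.2.symm⟩

lemma num_mul_den_sub {i : ℕ} (hi : i < T.n) :
    (T.num (i + 1) : ℤ) * T.den i - T.num i * T.den (i + 1) = 1 := by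
  have h := T.num_den_val_succ ⟨i, hi⟩
  have h₁ := T.num_val ⟨i, hi⟩
  have h₂ := T.den_val ⟨i, hi⟩
  dsimp only at h h₁ h₂
  rw [h.1, h.2, h₁, h₂]
  exact (T.Δ _).det_swap

lemma branch_eq {i : ℕ} (hi : i < T.n) (he : T.e ⟨i, hi⟩ = 1) :
    T.branch ⟨i, hi⟩ = ofSL (sl (T.num (i + 1)) (T.num i) (T.den (i + 1)) (T.den i)
      (T.num_mul_den_sub hi)) := by
  have h := T.num_den_val_succ ⟨i, hi⟩
  have h₁ := T.num_val ⟨i, hi⟩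
  have h₂ := T.den_val ⟨i, hi⟩
  dsimp only at h h₁ h₂
  rw [T.branch_of_one he]
  exact congrArg _ (sl_congr (by rw [h.1]) (by rw [h₁]) (by rw [h.2]) (by rw [h₂]))

end SlowAlgorithm

end SlowCF

/-! ### Turns along a Farey path -/

namespace SlowCF

open Matrix MatrixGroups

/-- The element `N⁻ᵏS` of `PSL₂(ℤ)`, the class of `(k 1; -1 0)`. -/
def turn (k : ℤ) : PG := ofSL (sl k 1 (-1) 0 (by ring))

lemma turn_eq_N_inv_mul (k : ℤ) : turn k = N⁻¹ * turn (k - 1) := by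
  rw [eq_inv_mul_iff_mul_eq, turn, turn, N_eq, ← map_mul, sl_mul]
  exact congrArg _ (sl_congr (by ring) (by ring) (by ring) (by ring))

lemma turn_one_eq : turn 1 = (S * R * S)⁻¹ := by
  rw [eq_comm, inv_eq_iff_mul_eq_one, turn, S_eq, R_eq, ← map_mul, ← map_mul, ← map_mul, sl_mul,
    sl_mul, sl_mul, ← ofSL_neg, sl_neg, ← map_one ofSL, ← sl_one]
  congr 1

lemma RSRS_le_of_N_sq_mem {H : Subgroup PG} (h1 : turn 1 ∈ H) (h2 : N ^ 2 ∈ H) : RSRS ≤ H := by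
  have hSRS : S * R * S ∈ H := by
    rwa [turn_one_eq, inv_mem_iff] at h1
  refine RSRS_le_iff.2 ⟨?_, hSRS⟩
  rw [N_eq_R_mul_S, pow_two, show R * S * (R * S) = R * (S * R * S) by simp only [mul_assoc]] at h2
  exact (Subgroup.mul_mem_cancel_right H hSRS).1 h2

/-- Dividing by `turn 1` leaves `N⁻¹` or `N⁻²`, and either one yields `N²`. -/
lemma RSRS_le_of_turn_mem {H : Subgroup PG} (h1 : turn 1 ∈ H) {k : ℤ} (hk : k = 2 ∨ k = 3)
    (h : turn k ∈ H) : RSRS ≤ H := by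
  refine RSRS_le_of_N_sq_mem h1 ?_
  have h2 : turn 2 = N⁻¹ * turn 1 := turn_eq_N_inv_mul 2
  have h3 : turn 3 = N⁻¹ * turn 2 := turn_eq_N_inv_mul 3
  rcases hk with rfl | rfl
  · rw [h2, Subgroup.mul_mem_cancel_right H h1, inv_mem_iff] at h
    exact pow_mem h 2
  · rwa [h3, h2, ← mul_assoc, Subgroup.mul_mem_cancel_right H h1, ← _root_.mul_inv_rev, inv_mem_iff,
      ← pow_two] at h

/-- Three consecutive Farey vectors satisfy a linear recurrence. -/
lemma farey_recurrence {a b c d e f : ℤ} (h₁ : c * b - a * d = 1) (h₂ : e * d - c * f = 1) :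
    a + e = (e * b - a * f) * c ∧ b + f = (e * b - a * f) * d :=
  ⟨by linear_combination (-e) * h₁ - a * h₂, by linear_combination (-f) * h₁ - b * h₂⟩

/-- By the recurrence the next vector is `k` times the middle one minus the previous one, so passing
to the next matrix is right multiplication by `(k 1; -1 0)`. -/
lemma turn_eq {a b c d e f : ℤ} (h₁ : c * b - a * d = 1) (h₂ : e * d - c * f = 1) :
    turn (e * b - a * f) = (ofSL (sl c a d b h₁))⁻¹ * ofSL (sl e c f d h₂) := by
  obtain ⟨h, h'⟩ := farey_recurrence h₁ h₂
  rw [eq_inv_mul_iff_mul_eq, turn, ← map_mul, sl_mul]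
  exact congrArg _ (sl_congr (by linarith) (by ring) (by linarith) (by ring))

/-- Two Farey neighbours of equal size are `0/1` and `1/0`. -/
lemma farey_eq_of_size_eq {a b c d : ℕ} (h : (c : ℤ) * b - a * d = 1) (hs : a + b = c + d) :
    a = 0 ∧ b = 1 ∧ c = 1 ∧ d = 0 := by
  -- Eliminating `d` factors the determinant.
  have h1 : ((c : ℤ) - a) * (a + b) = 1 := by
    zify at hs
    linear_combination h - (a : ℤ) * hs
  have h2 : ((a : ℤ) + b) = 1 := by
    rcases Int.eq_one_or_neg_one_of_mul_eq_one' h1 with h | h <;> omega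
  rw [h2] at h1
  omega

/-- If the matrices formed by consecutive vertices of a Farey path from `0/1` to `1/0` of length at
least two lie in `H`, then `H` contains `⟨R, SRS⟩`. -/
lemma RSRS_le_of_farey_path {H : Subgroup PG} {n : ℕ} (hn : 2 ≤ n) (x y : ℕ → ℕ)
    (hx0 : x 0 = 0) (hy0 : y 0 = 1) (hxn : x n = 1) (hyn : y n = 0)
    (hdet : ∀ i, i < n → (x (i + 1) : ℤ) * y i - x i * y (i + 1) = 1)
    (hH : ∀ i (hi : i < n), ofSL (sl (x (i + 1)) (x i) (y (i + 1)) (y i) (hdet i hi)) ∈ H) :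
    RSRS ≤ H := by
  -- The size of a vertex is `x + y`. Both ends of the path have size 1, so an interior maximum is a
  -- maximum over the whole path.
  obtain ⟨j, hj, hmax⟩ := Finset.exists_max_image (Finset.Ioo 0 n) (fun i ↦ x i + y i)
    ⟨1, by simp; omega⟩
  rw [Finset.mem_Ioo] at hj
  have hpos : ∀ i ≤ n, 1 ≤ x i + y i := by
    intro i hi
    by_contra! h
    have hx : x i = 0 := by omega
    have hy : y i = 0 := by omega
    rcases hi.eq_or_lt with rfl | hi
    · omega
    · have := hdet i hi
      simp [hx, hy] at this
  have hmax' : ∀ i ≤ n, x i + y i ≤ x j + y j := by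
    intro i hi
    rcases Nat.eq_zero_or_pos i with rfl | hi0
    · have := hpos j (by omega); omega
    rcases hi.eq_or_lt with rfl | hin
    · have := hpos j (by omega); omega
    · exact hmax i (Finset.mem_Ioo.2 ⟨hi0, hin⟩)
  /- The turn at an interior vertex, and its action on sizes. -/
  have hturn : ∀ i, i + 1 < n → ∃ k : ℤ, turn k ∈ H ∧
      k = (x (i + 2) : ℤ) * y i - x i * y (i + 2) ∧
      ((x i + y i : ℕ) : ℤ) + (x (i + 2) + y (i + 2) : ℕ) = k * (x (i + 1) + y (i + 1) : ℕ) := by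
    intro i hi
    refine ⟨_, ?_, rfl, ?_⟩
    · rw [turn_eq (hdet i (by omega)) (hdet (i + 1) hi)]
      exact mul_mem (inv_mem (hH i (by omega))) (hH (i + 1) hi)
    · obtain ⟨h, h'⟩ := farey_recurrence (hdet i (by omega)) (hdet (i + 1) hi)
      push_cast
      linear_combination h + h'
  obtain ⟨i, rfl⟩ : ∃ i, j = i + 1 := ⟨j - 1, by omega⟩
  obtain ⟨k, hkH, hk, hksize⟩ := hturn i hj.2
  have hp0 := hpos i (by omega)
  have hp1 := hpos (i + 1) (by omega)
  have hp2 := hpos (i + 2) (by omega)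
  have hm0 := hmax' i (by omega)
  have hm2 := hmax' (i + 2) (by omega)
  have hne : x i + y i ≠ x (i + 1) + y (i + 1) := by
    intro hs
    obtain ⟨-, -, hx, hy⟩ := farey_eq_of_size_eq (hdet i (by omega)) hs
    have := hdet (i + 1) hj.2
    rw [hx, hy] at this
    push_cast at this
    omega
  -- The neighbours' sizes sum to `k` times the maximal size; both are at most this maximum and the
  -- left one is strictly smaller, so `0 < k < 2`.
  have hk1 : k = 1 := by
    zify at *
    have : 0 < k := by
      by_contra! hk0
      nlinarith
    have : k < 2 := by
      by_contra! hk2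
      have : x i + y i < (x (i + 1) + y (i + 1) : ℤ) := lt_of_le_of_ne hm0 hne
      nlinarith
    omega
  subst hk1
  -- The maximal size is now the sum of its neighbours' sizes. If these differ, the larger
  -- neighbour, of size `s`, is interior, and the maximum lies strictly between `s` and `2s`. The
  -- two vertices adjacent to that neighbour therefore have sizes summing to more than `s` and less
  -- than `4s`, so the turn there is 2 or 3.
  rcases lt_trichotomy (x i + y i) (x (i + 2) + y (i + 2)) with hlt | heq | hlt
  · have hin : i + 2 < n := by
      by_contra! h
      obtain rfl : i + 2 = n := by omega
      omega
    obtain ⟨k', hkH', -, hksize'⟩ := hturn (i + 1) hin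
    have hm3 := hmax' (i + 3) (by omega)
    have hp3 := hpos (i + 3) (by omega)
    refine RSRS_le_of_turn_mem hkH ?_ hkH'
    zify at *
    simp only [show i + 1 + 2 = i + 3 by ring, show i + 1 + 1 = i + 2 by ring] at hksize'
    have : k' < 4 := by
      by_contra! hk4
      nlinarith
    have : 1 < k' := by
      by_contra! hk1
      nlinarith
    omega
  -- Neighbours of equal size must be 0/1 and 1/0. The path is then 0/1, 1/1, 1/0, and its second
  -- matrix is `N` itself.
  · obtain ⟨hxi, hyi, hx, hy⟩ := farey_eq_of_size_eq hk.symm heq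
    replace hx : x (i + 1 + 1) = 1 := hx
    replace hy : y (i + 1 + 1) = 0 := hy
    refine RSRS_le_of_N_sq_mem hkH (pow_mem ?_ 2)
    have h1 := hdet i (by omega)
    have h2 := hdet (i + 1) hj.2
    rw [hxi, hyi] at h1
    rw [hx, hy] at h2
    have := hH (i + 1) hj.2
    rw [N_eq]
    convert this using 2
    refine sl_congr ?_ ?_ ?_ ?_ <;> omega
  · obtain ⟨l, rfl⟩ : ∃ l, i = l + 1 := by
      refine ⟨i - 1, ?_⟩
      rcases Nat.eq_zero_or_pos i with rfl | h
      · omega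
      · omega
    obtain ⟨k', hkH', -, hksize'⟩ := hturn l (by omega)
    have hm3 := hmax' l (by omega)
    have hp3 := hpos l (by omega)
    refine RSRS_le_of_turn_mem hkH ?_ hkH'
    zify at *
    simp only [show l + 1 + 2 = l + 3 by ring, show l + 1 + 1 = l + 2 by ring] at *
    have : k' < 4 := by
      by_contra! hk4
      nlinarith
    have : 1 < k' := by
      by_contra! hk1
      nlinarith
    omega

end SlowCF

/-! ### The group generated by increasing branches -/

namespace SlowCF

open Matrix MatrixGroups

namespace SlowAlgorithm

variable (T : SlowAlgorithm)

lemma Sig_le_Gam (he : ∀ a, T.e a = 1) : T.Sig ≤ Gam := by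
  rw [Sig, Subgroup.closure_le, Set.range_subset_iff]
  intro a
  rw [T.branch_of_one (he a)]
  exact ofSL_mem_Gam _

lemma RSRS_le_Sig (he : ∀ a, T.e a = 1) : RSRS ≤ T.Sig := by
  refine RSRS_le_of_farey_path T.two_le T.num T.den T.num_zero T.den_zero T.num_n T.den_n
    (fun i hi ↦ T.num_mul_den_sub hi) fun i hi ↦ ?_
  rw [← T.branch_eq hi (he _)]
  exact Subgroup.subset_closure ⟨_, rfl⟩

lemma Sig_eq_Gam_iff (he : ∀ a, T.e a = 1) :
    T.Sig = Gam ↔ ∃ a, IsOddLNProduct (T.branch a) := by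
  constructor
  · intro h
    by_contra! hodd
    -- A branch that is not an odd word has trivial sign; if this held for every branch, Γ and with
    -- it `S` would lie in the kernel.
    have hle : T.Sig ≤ parity.ker := by
      rw [Sig, Subgroup.closure_le, Set.range_subset_iff]
      intro a
      by_contra hp
      refine hodd a ?_
      rw [SetLike.mem_coe, MonoidHom.mem_ker, T.branch_of_one (he a)] at hp
      rw [T.branch_of_one (he a)]
      exact isOddLNProduct_of_parity_ne_one _ hp
    have hS : parity S = 1 := hle (h ▸ S_mem_Gam)
    rw [parity_S] at hS
    exact ofAdd_one_ne_one hS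
  · rintro ⟨a, ha⟩
    refine (eq_Gam_or_eq_RSRS (T.RSRS_le_Sig he) (T.Sig_le_Gam he)).resolve_right fun h ↦ ?_
    have hmem : T.branch a ∈ T.Sig := Subgroup.subset_closure ⟨a, rfl⟩
    exact parity_ne_one_of_isOddLNProduct ha (RSRS_le_ker_parity (h ▸ hmem))

end SlowAlgorithm

end SlowCF

theorem corollary4p3 :
    -- `⟨R, SRS⟩` is the unique index-2 subgroup of `Γ = PSL₂(ℤ)`
    (SlowCF.RSRS ≤ SlowCF.Gam ∧ SlowCF.RSRS.relIndex SlowCF.Gam = 2 ∧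
      ∀ H : Subgroup SlowCF.PG, H ≤ SlowCF.Gam → H.relIndex SlowCF.Gam = 2 → H = SlowCF.RSRS) ∧
    ∀ T : SlowCF.SlowAlgorithm,
      ((∀ a, SlowCF.PosDet (T.branch a)) ↔ ∀ a, T.IncreasingOn a) ∧
      ((∀ a, SlowCF.PosDet (T.branch a)) →
        (T.Sig = SlowCF.Gam ∨ T.Sig = SlowCF.RSRS) ∧
        (T.Sig = SlowCF.Gam ↔ ∃ a, SlowCF.IsOddLNProduct (T.branch a))) := by
  refine ⟨⟨SlowCF.RSRS_le_Gam, SlowCF.relIndex_RSRS_Gam,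
    fun _ ↦ SlowCF.eq_RSRS_of_relIndex_eq_two⟩, fun T ↦ ⟨?_, fun hT ↦ ?_⟩⟩
  · exact forall_congr' fun a ↦ (T.posDet_branch_iff a).trans (T.increasingOn_iff a).symm
  · have he := fun a ↦ (T.posDet_branch_iff a).1 (hT a)
    exact ⟨SlowCF.eq_Gam_or_eq_RSRS (T.RSRS_le_Sig he) (T.Sig_le_Gam he), T.Sig_eq_Gam_iff he⟩
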